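/- Consider the quantum in-left-right-calculus without its nondeterministic elimination symbol $\delta_\oplus^{nd}$. Propositions are generated by $A ::= \mathbf 1 \mid A \multimap A \mid A\oplus A$, and proof-terms, taken modulo $\alpha$-equivalence, by $$t ::= x \mid t + t \mid a\bullet t \mid a.\star \mid \delta_{\mathbf 1}(t,t) \mid \lambda[x]t \mid t\,t \mid \mathrm{inl}(t)\mid \mathrm{inr}(t)\mid \mathrm{inlr}(t,t)\mid \delta_\oplus(t,[x]t,[y]t)\qquad (a\in\mathbb C).$$ The typing rules, with linear contexts (a comma denotes disjoint union), are: - $x:A\vdash x:A$, and $\vdash a.\star:\mathbf 1$; - if $\Gamma\vdash t:A$ and $\Gamma\vdash u:A$, then $\Gamma\vdash t+u:A$; if $\Gamma\vdash t:A$, then $\Gamma\vdash a\bullet t:A$; - if $\Gamma\vdash t:\mathbf 1$ and $\Delta\vdash u:A$, then $\Gamma,\Delta\vdash\delta_{\mathbf 1}(t,u):A$; - if $\Gamma,x:A\vdash t:B$, then $\Gamma\vdash\lambda[x]t:A\multimap B$; - if $\Gamma\vdash t:A\multimap B$ and $\Delta\vdash u:A$, then $\Gamma,\Delta\vdash t\,u:B$;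 - if $\Gamma\vdash t:A$, then $\Gamma\vdash \mathrm{inl}(t):A\oplus B$; if $\Gamma\vdash u:B$, then $\Gamma\vdash \mathrm{inr}(u):A\oplus B$; if both hold, then $\Gamma\vdash\mathrm{inlr}(t,u):A\oplus B$; - if $\Gamma\vdash t:A\oplus B$, $\Delta,x:A\vdash u:C$ and $\Delta,y:B\vdash v:C$, then $\Gamma,\Delta\vdash\delta_\oplus(t,[x]u,[y]v):C$. Reduction $\longrightarrow$ is the closure under all term constructors, including under binders, of the following rules: - $\delta_{\mathbf 1}(a.\star,t)\to a\bullet t$; $\ (\lambda[x]t)\,u\to (u/x)t$; $\ \delta_\oplus(\mathrm{inl}(t),[x]v,[y]w)\to(t/x)v$; $\ \delta_\oplus(\mathrm{inr}(u),[x]v,[y]w)\to(u/y)w$; $\ \delta_\oplus(\mathrm{inlr}(t,u),[x]v,[y]w)\to(t/x)v+(u/y)w$; - $a.\star+b.\star\to(a+b).\star$; $\ \lambda[x]t+\lambda[x]u\to\lambda[x](t+u)$; $\ \mathrm{inl}(t)+\mathrm{inl}(v)\to\mathrm{inl}(t+v)$; $\ \mathrm{inl}(t)+\mathrm{inr}(w)\to\mathrm{inlr}(t,w)$;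 $\ \mathrm{inl}(t)+\mathrm{inlr}(v,w)\to\mathrm{inlr}(t+v,w)$; $\ \mathrm{inr}(u)+\mathrm{inl}(v)\to\mathrm{inlr}(v,u)$; $\ \mathrm{inr}(u)+\mathrm{inr}(w)\to\mathrm{inr}(u+w)$; $\ \mathrm{inr}(u)+\mathrm{inlr}(v,w)\to\mathrm{inlr}(v,u+w)$; $\ \mathrm{inlr}(t,u)+\mathrm{inl}(v)\to\mathrm{inlr}(t+v,u)$; $\ \mathrm{inlr}(t,u)+\mathrm{inr}(w)\to\mathrm{inlr}(t,u+w)$; $\ \mathrm{inlr}(t,u)+\mathrm{inlr}(v,w)\to\mathrm{inlr}(t+v,u+w)$; - $a\bullet b.\star\to(ab).\star$; $\ a\bullet\lambda[x]t\to\lambda[x](a\bullet t)$; $\ a\bullet\mathrm{inl}(t)\to\mathrm{inl}(a\bullet t)$; $\ a\bullet\mathrm{inr}(t)\to\mathrm{inr}(a\bullet t)$; $\ a\bullet\mathrm{inlr}(t,u)\to\mathrm{inlr}(a\bullet t,a\bullet u)$. Write $t\equiv u$ if $t$ and $u$ each have exactly one normal form (irreducible reduct) and these two normal forms are equal. A closed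 proof of $A$ is a proof-term $t$ with $\vdash t:A$. The set $\mathcal V$ of vector propositions is the smallest set that contains $\mathbf 1$ and is closed under $\oplus$. Two closed proofs $t_1,t_2$ of a proposition $B$ are observationally equivalent, $t_1\sim t_2$, if for every $C\in\mathcal V$ and every proof $c$ with $\_:B\vdash c:C$ one has $(t_1/\_)c\equiv(t_2/\_)c$. **Theorem.** Let $A$ and $B$ be arbitrary propositions, $t$ a closed proof of $A\multimap B$, $u_1$ and $u_2$ closed proofs of $A$, and $a\in\mathbb C$. Then $$t\,(u_1+u_2)\ \sim\ t\,u_1+t\,u_2\qquad\text{and}\qquad t\,(a\bullet u_1)\ \sim\ a\bullet(t\,u_1).$$ -/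

import Mathlib

namespace QILR

/-- Propositions: the unit `𝟙`, the linear implication `A ⊸ B` and the additive
disjunction `A ⊕ B`. -/
inductive Ty : Type
  | one : Ty
  | lolli : Ty → Ty → Ty
  | oplus : Ty → Ty → Ty

/-- Proof-terms of the quantum in-left-right-calculus without the nondeterministic elimination
symbol, modulo α-equivalence: variables are de Bruijn indices. `lam t` binds one variable (index
`0`) in `t`; `elimPlus t u v` binds one variable in `u` and one variable in `v`. -/
inductive Tm : Type
  | var : ℕ → Tm
  | sum : Tm → Tm → Tm
  | prod : ℂ → Tm → Tm
  | star : ℂ → Tm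
  | elimOne : Tm → Tm → Tm
  | lam : Tm → Tm
  | app : Tm → Tm → Tm
  | inl : Tm → Tm
  | inr : Tm → Tm
  | inlr : Tm → Tm → Tm
  | elimPlus : Tm → Tm → Tm → Tm

namespace Tm

/-- Lifting of a renaming under a binder. -/
def upRen (ρ : ℕ → ℕ) : ℕ → ℕ
  | 0 => 0
  | n + 1 => ρ n + 1

/-- Renaming of free variables. -/
def rename (ρ : ℕ → ℕ) : Tm → Tm
  | var n => var (ρ n)
  | sum t u => sum (t.rename ρ) (u.rename ρ)
  | prod a t => prod a (t.rename ρ)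
  | star a => star a
  | elimOne t u => elimOne (t.rename ρ) (u.rename ρ)
  | lam t => lam (t.rename (upRen ρ))
  | app t u => app (t.rename ρ) (u.rename ρ)
  | inl t => inl (t.rename ρ)
  | inr t => inr (t.rename ρ)
  | inlr t u => inlr (t.rename ρ) (u.rename ρ)
  | elimPlus t u v => elimPlus (t.rename ρ) (u.rename (upRen ρ)) (v.rename (upRen ρ))

/-- Lifting of a simultaneous substitution under a binder. -/
def upSubst (σ : ℕ → Tm) : ℕ → Tm
  | 0 => var 0
  | n + 1 => (σ n).rename Nat.succ

/-- Simultaneous capture-avoiding substitution. -/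
def subst (σ : ℕ → Tm) : Tm → Tm
  | var n => σ n
  | sum t u => sum (t.subst σ) (u.subst σ)
  | prod a t => prod a (t.subst σ)
  | star a => star a
  | elimOne t u => elimOne (t.subst σ) (u.subst σ)
  | lam t => lam (t.subst (upSubst σ))
  | app t u => app (t.subst σ) (u.subst σ)
  | inl t => inl (t.subst σ)
  | inr t => inr (t.subst σ)
  | inlr t u => inlr (t.subst σ) (u.subst σ)
  | elimPlus t u v => elimPlus (t.subst σ) (u.subst (upSubst σ)) (v.subst (upSubst σ))

/-- The substitution `0 ↦ u`, `n + 1 ↦ n`. -/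
def single (u : Tm) : ℕ → Tm
  | 0 => u
  | n + 1 => var n

/-- `inst u t` is `(u/x)t`, where `x` is the variable of index `0` of `t`. -/
def inst (u t : Tm) : Tm := t.subst (single u)

end Tm

/-- A context assigns a proposition to each variable that it declares; `none` means that the
variable is not declared. -/
abbrev Ctx : Type := ℕ → Option Ty

/-- The empty context. -/
def Ctx.empty : Ctx := fun _ => none

/-- The context `Γ, x : A`, where `x` is the new variable of index `0`. -/
def Ctx.cons (A : Ty) (Γ : Ctx) : Ctx
  | 0 => some A
  | n + 1 => Γ n

/-- `Ctx.Split Γ Γ₁ Γ₂` says that `Γ` is the disjoint union `Γ₁, Γ₂`. -/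
def Ctx.Split (Γ Γ₁ Γ₂ : Ctx) : Prop :=
  ∀ n, (Γ₁ n = Γ n ∧ Γ₂ n = none) ∨ (Γ₁ n = none ∧ Γ₂ n = Γ n)

/-- The typing rules: `Typing Γ t A` is the judgement `Γ ⊢ t : A`. -/
inductive Typing : Ctx → Tm → Ty → Prop
  | ax {Γ : Ctx} {n : ℕ} {A : Ty} (h : Γ n = some A) (h' : ∀ m, m ≠ n → Γ m = none) :
      Typing Γ (.var n) A
  | sum {Γ : Ctx} {t u : Tm} {A : Ty} :
      Typing Γ t A → Typing Γ u A → Typing Γ (.sum t u) A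
  | prod {Γ : Ctx} {t : Tm} {A : Ty} (a : ℂ) :
      Typing Γ t A → Typing Γ (.prod a t) A
  | star {Γ : Ctx} (a : ℂ) (h : ∀ n, Γ n = none) :
      Typing Γ (.star a) .one
  | elimOne {Γ Γ₁ Γ₂ : Ctx} {t u : Tm} {A : Ty} (h : Ctx.Split Γ Γ₁ Γ₂) :
      Typing Γ₁ t .one → Typing Γ₂ u A → Typing Γ (.elimOne t u) A
  | lam {Γ : Ctx} {t : Tm} {A B : Ty} :
      Typing (Ctx.cons A Γ) t B → Typing Γ (.lam t) (.lolli A B)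
  | app {Γ Γ₁ Γ₂ : Ctx} {t u : Tm} {A B : Ty} (h : Ctx.Split Γ Γ₁ Γ₂) :
      Typing Γ₁ t (.lolli A B) → Typing Γ₂ u A → Typing Γ (.app t u) B
  | inl {Γ : Ctx} {t : Tm} {A B : Ty} :
      Typing Γ t A → Typing Γ (.inl t) (.oplus A B)
  | inr {Γ : Ctx} {t : Tm} {A B : Ty} :
      Typing Γ t B → Typing Γ (.inr t) (.oplus A B)
  | inlr {Γ : Ctx} {t u : Tm} {A B : Ty} :
      Typing Γ t A → Typing Γ u B → Typing Γ (.inlr t u) (.oplus A B)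
  | elimPlus {Γ Γ₁ Γ₂ : Ctx} {t u v : Tm} {A B C : Ty} (h : Ctx.Split Γ Γ₁ Γ₂) :
      Typing Γ₁ t (.oplus A B) → Typing (Ctx.cons A Γ₂) u C → Typing (Ctx.cons B Γ₂) v C →
        Typing Γ (.elimPlus t u v) C

/-- `t` is a closed proof of `A`. -/
def ClosedProof (t : Tm) (A : Ty) : Prop := Typing Ctx.empty t A

open Tm in
/-- One-step reduction: the reduction rules, closed under all term constructors. -/
inductive Step : Tm → Tm → Prop
  -- cuts
  | elimOne_star (a : ℂ) (t : Tm) : Step (elimOne (star a) t) (prod a t)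
  | beta (t u : Tm) : Step (app (lam t) u) (inst u t)
  | elimPlus_inl (t v w : Tm) : Step (elimPlus (inl t) v w) (inst t v)
  | elimPlus_inr (u v w : Tm) : Step (elimPlus (inr u) v w) (inst u w)
  | elimPlus_inlr (t u v w : Tm) :
      Step (elimPlus (inlr t u) v w) (sum (inst t v) (inst u w))
  -- sums of introductions
  | sum_star (a b : ℂ) : Step (sum (star a) (star b)) (star (a + b))
  | sum_lam (t u : Tm) : Step (sum (lam t) (lam u)) (lam (sum t u))
  | sum_inl_inl (t v : Tm) : Step (sum (inl t) (inl v)) (inl (sum t v))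
  | sum_inl_inr (t w : Tm) : Step (sum (inl t) (inr w)) (inlr t w)
  | sum_inl_inlr (t v w : Tm) : Step (sum (inl t) (inlr v w)) (inlr (sum t v) w)
  | sum_inr_inl (u v : Tm) : Step (sum (inr u) (inl v)) (inlr v u)
  | sum_inr_inr (u w : Tm) : Step (sum (inr u) (inr w)) (inr (sum u w))
  | sum_inr_inlr (u v w : Tm) : Step (sum (inr u) (inlr v w)) (inlr v (sum u w))
  | sum_inlr_inl (t u v : Tm) : Step (sum (inlr t u) (inl v)) (inlr (sum t v) u)
  | sum_inlr_inr (t u w : Tm) : Step (sum (inlr t u) (inr w)) (inlr t (sum u w))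
  | sum_inlr_inlr (t u v w : Tm) :
      Step (sum (inlr t u) (inlr v w)) (inlr (sum t v) (sum u w))
  -- products of introductions
  | prod_star (a b : ℂ) : Step (prod a (star b)) (star (a * b))
  | prod_lam (a : ℂ) (t : Tm) : Step (prod a (lam t)) (lam (prod a t))
  | prod_inl (a : ℂ) (t : Tm) : Step (prod a (inl t)) (inl (prod a t))
  | prod_inr (a : ℂ) (t : Tm) : Step (prod a (inr t)) (inr (prod a t))
  | prod_inlr (a : ℂ) (t u : Tm) : Step (prod a (inlr t u)) (inlr (prod a t) (prod a u))
  -- reduction inside a proof-term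
  | sum_left {t t' : Tm} (u : Tm) : Step t t' → Step (sum t u) (sum t' u)
  | sum_right (t : Tm) {u u' : Tm} : Step u u' → Step (sum t u) (sum t u')
  | prod_arg (a : ℂ) {t t' : Tm} : Step t t' → Step (prod a t) (prod a t')
  | elimOne_left {t t' : Tm} (u : Tm) : Step t t' → Step (elimOne t u) (elimOne t' u)
  | elimOne_right (t : Tm) {u u' : Tm} : Step u u' → Step (elimOne t u) (elimOne t u')
  | lam_body {t t' : Tm} : Step t t' → Step (lam t) (lam t')
  | app_left {t t' : Tm} (u : Tm) : Step t t' → Step (app t u) (app t' u)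
  | app_right (t : Tm) {u u' : Tm} : Step u u' → Step (app t u) (app t u')
  | inl_arg {t t' : Tm} : Step t t' → Step (inl t) (inl t')
  | inr_arg {t t' : Tm} : Step t t' → Step (inr t) (inr t')
  | inlr_left {t t' : Tm} (u : Tm) : Step t t' → Step (inlr t u) (inlr t' u)
  | inlr_right (t : Tm) {u u' : Tm} : Step u u' → Step (inlr t u) (inlr t u')
  | elimPlus_arg {t t' : Tm} (u v : Tm) : Step t t' → Step (elimPlus t u v) (elimPlus t' u v)
  | elimPlus_left (t : Tm) {u u' : Tm} (v : Tm) :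
      Step u u' → Step (elimPlus t u v) (elimPlus t u' v)
  | elimPlus_right (t u : Tm) {v v' : Tm} :
      Step v v' → Step (elimPlus t u v) (elimPlus t u v')

/-- Reduction in finitely many (possibly zero) steps. -/
def Reduces : Tm → Tm → Prop := Relation.ReflTransGen Step

/-- No rule applies anywhere in `t`. -/
def IsIrreducible (t : Tm) : Prop := ∀ t', ¬ Step t t'

/-- The set of the normal forms (irreducible reducts) of `t`. -/
def normalForms (t : Tm) : Set Tm := {v | Reduces t v ∧ IsIrreducible v}

/-- `t ≡ u`: both `t` and `u` have a normal form, it is unique, and it is the same for both. -/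
def SameNormalForm (t u : Tm) : Prop := ∃ v, normalForms t = {v} ∧ normalForms u = {v}

/-- The set `𝒱` of vector propositions. -/
inductive IsVector : Ty → Prop
  | one : IsVector .one
  | oplus {A B : Ty} : IsVector A → IsVector B → IsVector (.oplus A B)

/-- Observational equivalence of two closed proofs `t₁`, `t₂` of `B`: for every vector proposition
`C` and every proof `c` with `_ : B ⊢ c : C`, we have `(t₁/_)c ≡ (t₂/_)c`. -/
def ObsEq (B : Ty) (t₁ t₂ : Tm) : Prop :=
  ClosedProof t₁ B ∧ ClosedProof t₂ B ∧
    ∀ (C : Ty) (c : Tm), IsVector C → Typing (Ctx.cons B Ctx.empty) c C →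
      SameNormalForm (Tm.inst t₁ c) (Tm.inst t₂ c)

end QILR

/-!
Propositions are interpreted by modules over `ℂ` without a zero vector (`ZerolessModule`): `𝟙` by
`ℂ` itself, `A ⊸ B` by the linear maps, and `A ⊕ B` by the coproduct `M ⊎ N ⊎ (M × N)`, whose three
summands are the shapes `inl`, `inr` and `inlr`. Zero has to be left out, since adding a zero on the
other side would turn an `inl` into an `inlr`, which is a different normal form.

The logical relation `Realizes A t d` says that the term `t` computes the element `d` of the
denotation of `A`. By the fundamental lemma `Typing.exists_denotation`, a typed term has a
denotation that is linear in each of its variables and that is realized by all its closing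
instances; multilinearity comes from the linear contexts (`IsMultilinear.bilinear`). Both sides of
each of the two equivalences therefore realize the same element, because the denotation of `t` is a
linear map.

It remains to see that two realizers of the same element cannot be told apart. A context `c` of
vector type sends them to realizers of one element of a vector proposition, and such an element
prescribes a normal form to which all its realizers reduce (`Realizes.exists_normalForm`). That
normal form is unique because reduction is confluent on untyped terms (`Reduces.confluent`), which
is proved with parallel reduction and complete developments, in the variant of superdevelopments
where a redex created at the root by the reduction of the subterms may be contracted as well. So
neither subject reduction nor strong normalization is needed.
-/

namespace QILR

/-! ### Calculus of renamings and substitutions -/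

namespace Tm

theorem upRen_comp (ρ ρ' : ℕ → ℕ) : upRen (ρ' ∘ ρ) = upRen ρ' ∘ upRen ρ := by
  funext n; cases n <;> rfl

theorem rename_rename (t : Tm) (ρ ρ' : ℕ → ℕ) :
    (t.rename ρ).rename ρ' = t.rename (ρ' ∘ ρ) := by
  induction t generalizing ρ ρ' <;> simp_all [rename, upRen_comp]

theorem upSubst_comp_upRen (σ : ℕ → Tm) (ρ : ℕ → ℕ) :
    upSubst (σ ∘ ρ) = upSubst σ ∘ upRen ρ := by
  funext n; cases n <;> rfl

theorem subst_rename_left (t : Tm) (ρ : ℕ → ℕ) (σ : ℕ → Tm) :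
    (t.rename ρ).subst σ = t.subst (σ ∘ ρ) := by
  induction t generalizing ρ σ <;> simp_all [rename, subst, upSubst_comp_upRen]

theorem upSubst_rename (σ : ℕ → Tm) (ρ : ℕ → ℕ) :
    upSubst (rename ρ ∘ σ) = rename (upRen ρ) ∘ upSubst σ := by
  funext n
  cases n with
  | zero => rfl
  | succ n => simp only [upSubst, Function.comp, rename_rename]; rfl

theorem rename_subst (t : Tm) (σ : ℕ → Tm) (ρ : ℕ → ℕ) :
    (t.subst σ).rename ρ = t.subst (rename ρ ∘ σ) := by
  induction t generalizing ρ σ <;> simp_all [rename, subst, upSubst_rename]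

theorem upSubst_subst (σ τ : ℕ → Tm) :
    upSubst (subst τ ∘ σ) = subst (upSubst τ) ∘ upSubst σ := by
  funext n
  cases n with
  | zero => rfl
  | succ n => simp only [upSubst, Function.comp, subst_rename_left, rename_subst]; rfl

theorem subst_subst (t : Tm) (σ τ : ℕ → Tm) :
    (t.subst σ).subst τ = t.subst (subst τ ∘ σ) := by
  induction t generalizing σ τ <;> simp_all [subst, upSubst_subst]

theorem upSubst_var : upSubst var = var := by
  funext n; cases n <;> rfl

theorem subst_var (t : Tm) : t.subst var = t := by
  induction t <;> simp_all [subst, upSubst_var]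

/-- The substitution `0 ↦ u`, `n + 1 ↦ σ n`. -/
def scons (u : Tm) (σ : ℕ → Tm) : ℕ → Tm
  | 0 => u
  | n + 1 => σ n

theorem inst_subst_upSubst (t u : Tm) (σ : ℕ → Tm) :
    inst u (t.subst (upSubst σ)) = t.subst (scons u σ) := by
  rw [inst, subst_subst]
  congr 1
  funext n
  cases n with
  | zero => rfl
  | succ n =>
    simp only [upSubst, Function.comp, subst_rename_left, scons]
    exact subst_var _

theorem subst_inst (t u : Tm) (σ : ℕ → Tm) :
    (inst u t).subst σ = inst (u.subst σ) (t.subst (upSubst σ)) := by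
  rw [inst_subst_upSubst, inst, subst_subst]
  congr 1
  funext n
  cases n <;> rfl

theorem rename_inst (t u : Tm) (ρ : ℕ → ℕ) :
    (inst u t).rename ρ = inst (u.rename ρ) (t.rename (upRen ρ)) := by
  rw [inst, inst, rename_subst, subst_rename_left]
  congr 1
  funext n
  cases n <;> rfl

/-! ### Contraction of a redex at the root -/

/-- The contractum of `t + u` if it is a redex, and `t + u` itself otherwise. -/
def sumC : Tm → Tm → Tm
  | star a, star b => star (a + b)
  | lam t, lam u => lam (sum t u)
  | inl t, inl v => inl (sum t v)
  | inl t, inr w => inlr t w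
  | inl t, inlr v w => inlr (sum t v) w
  | inr u, inl v => inlr v u
  | inr u, inr w => inr (sum u w)
  | inr u, inlr v w => inlr v (sum u w)
  | inlr t u, inl v => inlr (sum t v) u
  | inlr t u, inr w => inlr t (sum u w)
  | inlr t u, inlr v w => inlr (sum t v) (sum u w)
  | t, u => sum t u

/-- The contractum of `a • t` if it is a redex, and `a • t` itself otherwise. -/
def prodC (a : ℂ) : Tm → Tm
  | star b => star (a * b)
  | lam t => lam (prod a t)
  | inl t => inl (prod a t)
  | inr t => inr (prod a t)
  | inlr t u => inlr (prod a t) (prod a u)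
  | t => prod a t

/-- The contractum of `δ₁(t, u)` if it is a redex, and `δ₁(t, u)` itself otherwise. -/
def elimOneC : Tm → Tm → Tm
  | star a, u => prod a u
  | t, u => elimOne t u

/-- The contractum of `t u` if it is a redex, and `t u` itself otherwise. -/
def appC : Tm → Tm → Tm
  | lam t, u => inst u t
  | t, u => app t u

/-- The contractum of `δ⊕(t, [x]v, [y]w)` if it is a redex, and that term itself otherwise. -/
def elimPlusC : Tm → Tm → Tm → Tm
  | inl t, v, _ => inst t v
  | inr u, _, w => inst u w
  | inlr t u, v, w => sum (inst t v) (inst u w)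
  | t, v, w => elimPlus t v w

theorem rename_sumC (ρ : ℕ → ℕ) (t u : Tm) :
    (sumC t u).rename ρ = sumC (t.rename ρ) (u.rename ρ) := by
  cases t <;> cases u <;> rfl

theorem rename_prodC (ρ : ℕ → ℕ) (a : ℂ) (t : Tm) :
    (prodC a t).rename ρ = prodC a (t.rename ρ) := by
  cases t <;> rfl

theorem rename_elimOneC (ρ : ℕ → ℕ) (t u : Tm) :
    (elimOneC t u).rename ρ = elimOneC (t.rename ρ) (u.rename ρ) := by
  cases t <;> rfl

theorem rename_appC (ρ : ℕ → ℕ) (t u : Tm) :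
    (appC t u).rename ρ = appC (t.rename ρ) (u.rename ρ) := by
  cases t <;> first | rfl | exact rename_inst _ _ _

theorem rename_elimPlusC (ρ : ℕ → ℕ) (t v w : Tm) :
    (elimPlusC t v w).rename ρ =
      elimPlusC (t.rename ρ) (v.rename (upRen ρ)) (w.rename (upRen ρ)) := by
  cases t <;> simp only [elimPlusC, rename, rename_inst]

/-! A substitution can create a redex at the root, so it may fail to commute with the contraction;
but then nothing is contracted on the left-hand side. -/

theorem subst_sumC (σ : ℕ → Tm) (t u : Tm) :
    (sumC t u).subst σ = sumC (t.subst σ) (u.subst σ) ∨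
      (sumC t u).subst σ = sum (t.subst σ) (u.subst σ) := by
  cases t <;> cases u <;> first | exact Or.inl rfl | exact Or.inr rfl

theorem subst_prodC (σ : ℕ → Tm) (a : ℂ) (t : Tm) :
    (prodC a t).subst σ = prodC a (t.subst σ) ∨ (prodC a t).subst σ = prod a (t.subst σ) := by
  cases t <;> first | exact Or.inl rfl | exact Or.inr rfl

theorem subst_elimOneC (σ : ℕ → Tm) (t u : Tm) :
    (elimOneC t u).subst σ = elimOneC (t.subst σ) (u.subst σ) ∨
      (elimOneC t u).subst σ = elimOne (t.subst σ) (u.subst σ) := by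
  cases t <;> first | exact Or.inl rfl | exact Or.inr rfl

theorem subst_appC (σ : ℕ → Tm) (t u : Tm) :
    (appC t u).subst σ = appC (t.subst σ) (u.subst σ) ∨
      (appC t u).subst σ = app (t.subst σ) (u.subst σ) := by
  cases t <;> first | exact Or.inr rfl | exact Or.inl (subst_inst _ _ _)

theorem subst_elimPlusC (σ : ℕ → Tm) (t v w : Tm) :
    (elimPlusC t v w).subst σ =
        elimPlusC (t.subst σ) (v.subst (upSubst σ)) (w.subst (upSubst σ)) ∨
      (elimPlusC t v w).subst σ =
        elimPlus (t.subst σ) (v.subst (upSubst σ)) (w.subst (upSubst σ)) := by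
  cases t <;>
    first | exact Or.inr rfl | exact Or.inl (by simp only [elimPlusC, subst, subst_inst])

end Tm

/-! ### Confluence -/

open Tm in
/-- Parallel reduction in the style of superdevelopments: the subterms are reduced first, and then
the redex that has possibly appeared at the root may be contracted. -/
inductive Par : Tm → Tm → Prop
  | var (n : ℕ) : Par (var n) (var n)
  | sum {t t' u u' : Tm} : Par t t' → Par u u' → Par (sum t u) (sum t' u')
  | prod (a : ℂ) {t t' : Tm} : Par t t' → Par (prod a t) (prod a t')
  | star (a : ℂ) : Par (star a) (star a)
  | elimOne {t t' u u' : Tm} : Par t t' → Par u u' → Par (elimOne t u) (elimOne t' u')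
  | lam {t t' : Tm} : Par t t' → Par (lam t) (lam t')
  | app {t t' u u' : Tm} : Par t t' → Par u u' → Par (app t u) (app t' u')
  | inl {t t' : Tm} : Par t t' → Par (inl t) (inl t')
  | inr {t t' : Tm} : Par t t' → Par (inr t) (inr t')
  | inlr {t t' u u' : Tm} : Par t t' → Par u u' → Par (inlr t u) (inlr t' u')
  | elimPlus {t t' u u' v v' : Tm} : Par t t' → Par u u' → Par v v' →
      Par (elimPlus t u v) (elimPlus t' u' v')
  | sumC {t t' u u' : Tm} : Par t t' → Par u u' → Par (sum t u) (sumC t' u')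
  | prodC (a : ℂ) {t t' : Tm} : Par t t' → Par (prod a t) (prodC a t')
  | elimOneC {t t' u u' : Tm} : Par t t' → Par u u' → Par (elimOne t u) (elimOneC t' u')
  | appC {t t' u u' : Tm} : Par t t' → Par u u' → Par (app t u) (appC t' u')
  | elimPlusC {t t' u u' v v' : Tm} : Par t t' → Par u u' → Par v v' →
      Par (elimPlus t u v) (elimPlusC t' u' v')

namespace Par

theorem refl (t : Tm) : Par t t := by
  induction t <;> constructor <;> assumption

theorem rename {t t' : Tm} (h : Par t t') (ρ : ℕ → ℕ) : Par (t.rename ρ) (t'.rename ρ) := by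
  induction h generalizing ρ with
  | sumC _ _ h₁ h₂ => rw [Tm.rename_sumC]; exact .sumC (h₁ _) (h₂ _)
  | prodC a _ h => rw [Tm.rename_prodC]; exact .prodC a (h _)
  | elimOneC _ _ h₁ h₂ => rw [Tm.rename_elimOneC]; exact .elimOneC (h₁ _) (h₂ _)
  | appC _ _ h₁ h₂ => rw [Tm.rename_appC]; exact .appC (h₁ _) (h₂ _)
  | elimPlusC _ _ _ h₁ h₂ h₃ =>
    rw [Tm.rename_elimPlusC]; exact .elimPlusC (h₁ _) (h₂ _) (h₃ _)
  | _ => constructor <;> apply_assumption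

theorem upSubst {σ σ' : ℕ → Tm} (hσ : ∀ n, Par (σ n) (σ' n)) (n : ℕ) :
    Par (Tm.upSubst σ n) (Tm.upSubst σ' n) := by
  cases n with
  | zero => exact .var 0
  | succ n => exact (hσ n).rename _

theorem subst {t t' : Tm} (h : Par t t') {σ σ' : ℕ → Tm} (hσ : ∀ n, Par (σ n) (σ' n)) :
    Par (t.subst σ) (t'.subst σ') := by
  induction h generalizing σ σ' with
  | var n => exact hσ n
  | star a => exact .star a
  | sum _ _ h₁ h₂ => exact .sum (h₁ hσ) (h₂ hσ)
  | prod a _ h => exact .prod a (h hσ)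
  | elimOne _ _ h₁ h₂ => exact .elimOne (h₁ hσ) (h₂ hσ)
  | lam _ h => exact .lam (h (upSubst hσ))
  | app _ _ h₁ h₂ => exact .app (h₁ hσ) (h₂ hσ)
  | inl _ h => exact .inl (h hσ)
  | inr _ h => exact .inr (h hσ)
  | inlr _ _ h₁ h₂ => exact .inlr (h₁ hσ) (h₂ hσ)
  | elimPlus _ _ _ h₁ h₂ h₃ =>
    exact .elimPlus (h₁ hσ) (h₂ (upSubst hσ)) (h₃ (upSubst hσ))
  | @sumC t t' u u' _ _ h₁ h₂ =>
    rcases Tm.subst_sumC σ' t' u' with e | e <;> rw [e]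
    exacts [.sumC (h₁ hσ) (h₂ hσ), .sum (h₁ hσ) (h₂ hσ)]
  | @prodC a t t' _ h =>
    rcases Tm.subst_prodC σ' a t' with e | e <;> rw [e]
    exacts [.prodC a (h hσ), .prod a (h hσ)]
  | @elimOneC t t' u u' _ _ h₁ h₂ =>
    rcases Tm.subst_elimOneC σ' t' u' with e | e <;> rw [e]
    exacts [.elimOneC (h₁ hσ) (h₂ hσ), .elimOne (h₁ hσ) (h₂ hσ)]
  | @appC t t' u u' _ _ h₁ h₂ =>
    rcases Tm.subst_appC σ' t' u' with e | e <;> rw [e]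
    exacts [.appC (h₁ hσ) (h₂ hσ), .app (h₁ hσ) (h₂ hσ)]
  | @elimPlusC t t' u u' v v' _ _ _ h₁ h₂ h₃ =>
    rcases Tm.subst_elimPlusC σ' t' u' v' with e | e <;> rw [e]
    exacts [.elimPlusC (h₁ hσ) (h₂ (upSubst hσ)) (h₃ (upSubst hσ)),
      .elimPlus (h₁ hσ) (h₂ (upSubst hσ)) (h₃ (upSubst hσ))]

theorem inst {t t' u u' : Tm} (ht : Par t t') (hu : Par u u') :
    Par (Tm.inst u t) (Tm.inst u' t') := by
  refine ht.subst fun n => ?_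
  cases n with
  | zero => exact hu
  | succ n => exact .var n

/-! Contraction at the root is monotone: if there is a redex in the source, then its principal
subterms are introductions, which only reduce to introductions of the same shape. -/

theorem sumC_mono {t t' u u' : Tm} (ht : Par t t') (hu : Par u u') :
    Par (Tm.sumC t u) (Tm.sumC t' u') := by
  cases t <;> cases u <;>
    first
    | exact .sumC ht hu
    | (cases ht; cases hu; simp only [Tm.sumC]; repeat (first | assumption | constructor))

theorem prodC_mono (a : ℂ) {t t' : Tm} (ht : Par t t') :
    Par (Tm.prodC a t) (Tm.prodC a t') := by
  cases t <;>
    first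
    | exact .prodC a ht
    | (cases ht; simp only [Tm.prodC]; repeat (first | assumption | constructor))

theorem elimOneC_mono {t t' u u' : Tm} (ht : Par t t') (hu : Par u u') :
    Par (Tm.elimOneC t u) (Tm.elimOneC t' u') := by
  cases t <;>
    first
    | exact .elimOneC ht hu
    | (cases ht; exact .prod _ hu)

theorem appC_mono {t t' u u' : Tm} (ht : Par t t') (hu : Par u u') :
    Par (Tm.appC t u) (Tm.appC t' u') := by
  cases t <;>
    first
    | exact .appC ht hu
    | (cases ht; exact inst ‹_› hu)

theorem elimPlusC_mono {t t' u u' v v' : Tm} (ht : Par t t') (hu : Par u u') (hv : Par v v') :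
    Par (Tm.elimPlusC t u v) (Tm.elimPlusC t' u' v') := by
  cases t with
  | inl t => cases ht with | inl ht => exact inst hu ht
  | inr t => cases ht with | inr ht => exact inst hv ht
  | inlr t s => cases ht with | inlr ht hs => exact .sum (inst hu ht) (inst hv hs)
  | _ => exact .elimPlusC ht hu hv

end Par

/-- The complete superdevelopment of a term: from the leaves to the root, each node that is a redex
once its subterms have been developed is contracted. -/
def Tm.dev : Tm → Tm
  | var n => var n
  | sum t u => sumC t.dev u.dev
  | prod a t => prodC a t.dev
  | star a => star a
  | elimOne t u => elimOneC t.dev u.dev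
  | lam t => lam t.dev
  | app t u => appC t.dev u.dev
  | inl t => inl t.dev
  | inr t => inr t.dev
  | inlr t u => inlr t.dev u.dev
  | elimPlus t u v => elimPlusC t.dev u.dev v.dev

theorem Par.par_dev {t t' : Tm} (h : Par t t') : Par t' t.dev := by
  induction h with
  | var n => exact .var n
  | star a => exact .star a
  | sum _ _ h₁ h₂ => exact .sumC h₁ h₂
  | prod a _ h => exact .prodC a h
  | elimOne _ _ h₁ h₂ => exact .elimOneC h₁ h₂
  | lam _ h => exact .lam h
  | app _ _ h₁ h₂ => exact .appC h₁ h₂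
  | inl _ h => exact .inl h
  | inr _ h => exact .inr h
  | inlr _ _ h₁ h₂ => exact .inlr h₁ h₂
  | elimPlus _ _ _ h₁ h₂ h₃ => exact .elimPlusC h₁ h₂ h₃
  | sumC _ _ h₁ h₂ => exact sumC_mono h₁ h₂
  | prodC a _ h => exact prodC_mono a h
  | elimOneC _ _ h₁ h₂ => exact elimOneC_mono h₁ h₂
  | appC _ _ h₁ h₂ => exact appC_mono h₁ h₂
  | elimPlusC _ _ _ h₁ h₂ h₃ => exact elimPlusC_mono h₁ h₂ h₃

theorem Step.par {t t' : Tm} (h : Step t t') : Par t t' := by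
  induction h with
  | elimOne_star a t => exact .elimOneC (.refl _) (.refl _)
  | beta t u => exact .appC (.refl (.lam t)) (.refl u)
  | elimPlus_inl t v w => exact .elimPlusC (.refl (.inl t)) (.refl v) (.refl w)
  | elimPlus_inr u v w => exact .elimPlusC (.refl (.inr u)) (.refl v) (.refl w)
  | elimPlus_inlr t u v w => exact .elimPlusC (.refl (.inlr t u)) (.refl v) (.refl w)
  | prod_star a b => exact .prodC a (.refl (.star b))
  | prod_lam a t => exact .prodC a (.refl (.lam t))
  | prod_inl a t => exact .prodC a (.refl (.inl t))
  | prod_inr a t => exact .prodC a (.refl (.inr t))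
  | prod_inlr a t u => exact .prodC a (.refl (.inlr t u))
  | sum_left u _ h => exact .sum h (.refl _)
  | sum_right t _ h => exact .sum (.refl _) h
  | prod_arg a _ h => exact .prod a h
  | elimOne_left u _ h => exact .elimOne h (.refl _)
  | elimOne_right t _ h => exact .elimOne (.refl _) h
  | lam_body _ h => exact .lam h
  | app_left u _ h => exact .app h (.refl _)
  | app_right t _ h => exact .app (.refl _) h
  | inl_arg _ h => exact .inl h
  | inr_arg _ h => exact .inr h
  | inlr_left u _ h => exact .inlr h (.refl _)
  | inlr_right t _ h => exact .inlr (.refl _) h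
  | elimPlus_arg u v _ h => exact .elimPlus h (.refl _) (.refl _)
  | elimPlus_left t v _ h => exact .elimPlus (.refl _) h (.refl _)
  | elimPlus_right t u _ h => exact .elimPlus (.refl _) (.refl _) h
  | _ => exact .sumC (.refl _) (.refl _)

namespace Reduces

theorem refl (t : Tm) : Reduces t t := Relation.ReflTransGen.refl

theorem trans {t u v : Tm} (h₁ : Reduces t u) (h₂ : Reduces u v) : Reduces t v :=
  Relation.ReflTransGen.trans h₁ h₂

theorem of_step {t u : Tm} (h : Step t u) : Reduces t u := Relation.ReflTransGen.single h

theorem sum {t t' u u' : Tm} (ht : Reduces t t') (hu : Reduces u u') :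
    Reduces (.sum t u) (.sum t' u') :=
  (ht.lift (Tm.sum · u) fun _ _ => .sum_left u).trans
    (hu.lift (Tm.sum t' ·) fun _ _ => .sum_right t')

theorem prod (a : ℂ) {t t' : Tm} (ht : Reduces t t') : Reduces (.prod a t) (.prod a t') :=
  ht.lift (Tm.prod a) fun _ _ => .prod_arg a

theorem elimOne {t t' u u' : Tm} (ht : Reduces t t') (hu : Reduces u u') :
    Reduces (.elimOne t u) (.elimOne t' u') :=
  (ht.lift (Tm.elimOne · u) fun _ _ => .elimOne_left u).trans
    (hu.lift (Tm.elimOne t' ·) fun _ _ => .elimOne_right t')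

theorem lam {t t' : Tm} (ht : Reduces t t') : Reduces (.lam t) (.lam t') :=
  ht.lift Tm.lam fun _ _ => .lam_body

theorem app {t t' u u' : Tm} (ht : Reduces t t') (hu : Reduces u u') :
    Reduces (.app t u) (.app t' u') :=
  (ht.lift (Tm.app · u) fun _ _ => .app_left u).trans
    (hu.lift (Tm.app t' ·) fun _ _ => .app_right t')

theorem inl {t t' : Tm} (ht : Reduces t t') : Reduces (.inl t) (.inl t') :=
  ht.lift Tm.inl fun _ _ => .inl_arg

theorem inr {t t' : Tm} (ht : Reduces t t') : Reduces (.inr t) (.inr t') :=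
  ht.lift Tm.inr fun _ _ => .inr_arg

theorem inlr {t t' u u' : Tm} (ht : Reduces t t') (hu : Reduces u u') :
    Reduces (.inlr t u) (.inlr t' u') :=
  (ht.lift (Tm.inlr · u) fun _ _ => .inlr_left u).trans
    (hu.lift (Tm.inlr t' ·) fun _ _ => .inlr_right t')

theorem elimPlus {t t' u u' v v' : Tm} (ht : Reduces t t') (hu : Reduces u u')
    (hv : Reduces v v') : Reduces (.elimPlus t u v) (.elimPlus t' u' v') :=
  (ht.lift (Tm.elimPlus · u v) fun _ _ => .elimPlus_arg u v).trans
    ((hu.lift (Tm.elimPlus t' · v) fun _ _ => .elimPlus_left t' v).trans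
      (hv.lift (Tm.elimPlus t' u' ·) fun _ _ => .elimPlus_right t' u'))

theorem sumC (t u : Tm) : Reduces (.sum t u) (Tm.sumC t u) := by
  cases t <;> cases u <;> first | exact refl _ | (apply of_step; constructor)

theorem prodC (a : ℂ) (t : Tm) : Reduces (.prod a t) (Tm.prodC a t) := by
  cases t <;> first | exact refl _ | (apply of_step; constructor)

theorem elimOneC (t u : Tm) : Reduces (.elimOne t u) (Tm.elimOneC t u) := by
  cases t <;> first | exact refl _ | (apply of_step; constructor)

theorem appC (t u : Tm) : Reduces (.app t u) (Tm.appC t u) := by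
  cases t <;> first | exact refl _ | (apply of_step; constructor)

theorem elimPlusC (t u v : Tm) : Reduces (.elimPlus t u v) (Tm.elimPlusC t u v) := by
  cases t <;> first | exact refl _ | (apply of_step; constructor)

end Reduces

theorem Par.reduces {t t' : Tm} (h : Par t t') : Reduces t t' := by
  induction h with
  | var n => exact .refl _
  | star a => exact .refl _
  | sum _ _ h₁ h₂ => exact .sum h₁ h₂
  | prod a _ h => exact .prod a h
  | elimOne _ _ h₁ h₂ => exact .elimOne h₁ h₂
  | lam _ h => exact .lam h
  | app _ _ h₁ h₂ => exact .app h₁ h₂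
  | inl _ h => exact .inl h
  | inr _ h => exact .inr h
  | inlr _ _ h₁ h₂ => exact .inlr h₁ h₂
  | elimPlus _ _ _ h₁ h₂ h₃ => exact .elimPlus h₁ h₂ h₃
  | sumC _ _ h₁ h₂ => exact (Reduces.sum h₁ h₂).trans (.sumC _ _)
  | prodC a _ h => exact (Reduces.prod a h).trans (.prodC _ _)
  | elimOneC _ _ h₁ h₂ => exact (Reduces.elimOne h₁ h₂).trans (.elimOneC _ _)
  | appC _ _ h₁ h₂ => exact (Reduces.app h₁ h₂).trans (.appC _ _)
  | elimPlusC _ _ _ h₁ h₂ h₃ => exact (Reduces.elimPlus h₁ h₂ h₃).trans (.elimPlusC _ _ _)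

/-- Reduction is confluent on all terms, typed or not. -/
theorem Reduces.confluent {t u v : Tm} (hu : Reduces t u) (hv : Reduces t v) :
    ∃ w, Reduces u w ∧ Reduces v w := by
  have toPar {a b : Tm} (h : Reduces a b) : Relation.ReflTransGen Par a b :=
    h.lift id fun _ _ => Step.par
  have ofPar {a b : Tm} (h : Relation.ReflTransGen Par a b) : Reduces a b := by
    induction h with
    | refl => exact .refl _
    | tail _ h ih => exact ih.trans h.reduces
  obtain ⟨w, h₁, h₂⟩ := Relation.church_rosser
    (fun a _ _ hb hc => ⟨a.dev, .single hb.par_dev, .single hc.par_dev⟩) (toPar hu) (toPar hv)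
  exact ⟨w, ofPar h₁, ofPar h₂⟩

theorem IsIrreducible.eq_of_reduces {t u : Tm} (ht : IsIrreducible t) (h : Reduces t u) :
    u = t := by
  rcases Relation.ReflTransGen.cases_head h with h | ⟨v, hv, _⟩
  exacts [h.symm, absurd hv (ht v)]

theorem normalForms_eq_singleton {t v : Tm} (h : Reduces t v) (hv : IsIrreducible v) :
    normalForms t = {v} := by
  ext w
  refine ⟨fun ⟨hw, hw'⟩ => ?_, ?_⟩
  · obtain ⟨x, h₁, h₂⟩ := hw.confluent h
    rw [hw'.eq_of_reduces h₁] at h₂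
    exact hv.eq_of_reduces h₂
  · rintro rfl
    exact ⟨h, hv⟩

/-! ### Modules without zero -/

/-- A module over `ℂ` without a zero vector: scalar multiplication distributes over sums on both
sides, but `0 • x` need not be neutral. There is no zero because `inl` and `inlr` are told apart:
adding `0 • inr u` to `inl t` changes its normal form. -/
class ZerolessModule (M : Type) extends AddCommSemigroup M, MulAction ℂ M where
  smul_add' (a : ℂ) (x y : M) : a • (x + y) = a • x + a • y
  add_smul' (a b : ℂ) (x : M) : (a + b) • x = a • x + b • x

namespace ZerolessModule

variable {M : Type} [ZerolessModule M]

theorem smul_comm' (a b : ℂ) (x : M) : a • b • x = b • a • x := by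
  rw [← mul_smul, ← mul_smul, mul_comm]

end ZerolessModule

open ZerolessModule

instance : ZerolessModule ℂ where
  smul_add' := smul_add
  add_smul' := add_smul

/-- Maps that preserve sums and scalar multiples. -/
@[ext]
structure LinMap (M N : Type) [ZerolessModule M] [ZerolessModule N] where
  toFun : M → N
  map_add (x y : M) : toFun (x + y) = toFun x + toFun y
  map_smul (a : ℂ) (x : M) : toFun (a • x) = a • toFun x

namespace LinMap

variable {M N : Type} [ZerolessModule M] [ZerolessModule N]

instance : Add (LinMap M N) where
  add f g :=
    { toFun := fun x => f.toFun x + g.toFun x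
      map_add := fun x y => by rw [f.map_add, g.map_add, add_add_add_comm]
      map_smul := fun a x => by rw [f.map_smul, g.map_smul, smul_add'] }

instance : SMul ℂ (LinMap M N) where
  smul a f :=
    { toFun := fun x => a • f.toFun x
      map_add := fun x y => by rw [f.map_add, smul_add']
      map_smul := fun b x => by rw [f.map_smul, smul_comm'] }

instance : ZerolessModule (LinMap M N) where
  add_assoc _ _ _ := LinMap.ext (funext fun _ => add_assoc _ _ _)
  add_comm _ _ := LinMap.ext (funext fun _ => add_comm _ _)
  mul_smul _ _ _ := LinMap.ext (funext fun _ => mul_smul _ _ _)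
  one_smul _ := LinMap.ext (funext fun _ => one_smul _ _)
  smul_add' _ _ _ := LinMap.ext (funext fun _ => smul_add' _ _ _)
  add_smul' _ _ _ := LinMap.ext (funext fun _ => add_smul' _ _ _)

end LinMap

/-- The coproduct of two modules without zero. Its elements are those of `M`, those of `N` and the
formal sums of an element of `M` and an element of `N`. -/
inductive Coprod (M N : Type) : Type
  | inl : M → Coprod M N
  | inr : N → Coprod M N
  | inlr : M → N → Coprod M N

namespace Coprod

variable {M N P : Type} [ZerolessModule M] [ZerolessModule N] [ZerolessModule P]

instance : Add (Coprod M N) where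
  add
    | inl x, inl y => inl (x + y)
    | inl x, inr w => inlr x w
    | inl x, inlr y w => inlr (x + y) w
    | inr v, inl y => inlr y v
    | inr v, inr w => inr (v + w)
    | inr v, inlr y w => inlr y (v + w)
    | inlr x v, inl y => inlr (x + y) v
    | inlr x v, inr w => inlr x (v + w)
    | inlr x v, inlr y w => inlr (x + y) (v + w)

instance : SMul ℂ (Coprod M N) where
  smul
    | a, inl x => inl (a • x)
    | a, inr v => inr (a • v)
    | a, inlr x v => inlr (a • x) (a • v)

instance : ZerolessModule (Coprod M N) where
  add_assoc x y z := by
    rcases x with x | v | ⟨x, v⟩ <;> rcases y with y | w | ⟨y, w⟩ <;>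
      rcases z with z | u | ⟨z, u⟩ <;>
        first
        | rfl
        | exact congrArg inl (add_assoc _ _ _)
        | exact congrArg inr (add_assoc _ _ _)
        | exact congrArg₂ inlr (add_assoc _ _ _) rfl
        | exact congrArg₂ inlr rfl (add_assoc _ _ _)
        | exact congrArg₂ inlr (add_assoc _ _ _) (add_assoc _ _ _)
  add_comm x y := by
    rcases x with x | v | ⟨x, v⟩ <;> rcases y with y | w | ⟨y, w⟩ <;>
      first
      | rfl
      | exact congrArg inl (add_comm _ _)
      | exact congrArg inr (add_comm _ _)
      | exact congrArg₂ inlr (add_comm _ _) rfl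
      | exact congrArg₂ inlr rfl (add_comm _ _)
      | exact congrArg₂ inlr (add_comm _ _) (add_comm _ _)
  mul_smul a b x := by
    rcases x with x | v | ⟨x, v⟩
    exacts [congrArg inl (mul_smul _ _ _), congrArg inr (mul_smul _ _ _),
      congrArg₂ inlr (mul_smul _ _ _) (mul_smul _ _ _)]
  one_smul x := by
    rcases x with x | v | ⟨x, v⟩
    exacts [congrArg inl (one_smul _ _), congrArg inr (one_smul _ _),
      congrArg₂ inlr (one_smul _ _) (one_smul _ _)]
  smul_add' a x y := by
    rcases x with x | v | ⟨x, v⟩ <;> rcases y with y | w | ⟨y, w⟩ <;>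
      first
      | rfl
      | exact congrArg inl (smul_add' _ _ _)
      | exact congrArg inr (smul_add' _ _ _)
      | exact congrArg₂ inlr (smul_add' _ _ _) rfl
      | exact congrArg₂ inlr rfl (smul_add' _ _ _)
      | exact congrArg₂ inlr (smul_add' _ _ _) (smul_add' _ _ _)
  add_smul' a b x := by
    rcases x with x | v | ⟨x, v⟩
    exacts [congrArg inl (add_smul' _ _ _), congrArg inr (add_smul' _ _ _),
      congrArg₂ inlr (add_smul' _ _ _) (add_smul' _ _ _)]

/-- Case analysis on the coproduct; the two results are added on a formal sum. -/
def elim (f : M → P) (g : N → P) : Coprod M N → P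
  | inl x => f x
  | inr v => g v
  | inlr x v => f x + g v

theorem elim_add (f : LinMap M P) (g : LinMap N P) (x y : Coprod M N) :
    elim f.toFun g.toFun (x + y) = elim f.toFun g.toFun x + elim f.toFun g.toFun y := by
  rcases x with x | v | ⟨x, v⟩ <;> rcases y with y | w | ⟨y, w⟩ <;>
    simp only [elim]
  · exact f.map_add x y
  · exact (congrArg (· + _) (f.map_add x y)).trans (add_assoc _ _ _)
  · exact add_comm _ _
  · exact g.map_add v w
  · exact (congrArg (_ + ·) (g.map_add v w)).trans (add_left_comm _ _ _)
  · exact (congrArg (· + _) (f.map_add x y)).trans (add_right_comm _ _ _)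
  · exact (congrArg (_ + ·) (g.map_add v w)).trans (add_assoc _ _ _).symm
  · exact (congrArg₂ (· + ·) (f.map_add x y) (g.map_add v w)).trans (add_add_add_comm _ _ _ _)

theorem elim_smul (f : LinMap M P) (g : LinMap N P) (a : ℂ) (x : Coprod M N) :
    elim f.toFun g.toFun (a • x) = a • elim f.toFun g.toFun x := by
  rcases x with x | v | ⟨x, v⟩
  · exact f.map_smul a x
  · exact g.map_smul a v
  · exact (congrArg₂ (· + ·) (f.map_smul a x) (g.map_smul a v)).trans (smul_add' _ _ _).symm

end Coprod

namespace LinMap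

variable {M N P : Type} [ZerolessModule M] [ZerolessModule N] [ZerolessModule P]

/-- The linear map out of the coproduct that is given by its two restrictions. -/
def copair (f : LinMap M P) (g : LinMap N P) : LinMap (Coprod M N) P where
  toFun := Coprod.elim f.toFun g.toFun
  map_add := Coprod.elim_add f g
  map_smul := Coprod.elim_smul f g

theorem copair_add (f f' : LinMap M P) (g g' : LinMap N P) :
    copair (f + f') (g + g') = copair f g + copair f' g' := by
  refine LinMap.ext (funext fun x => ?_)
  rcases x with x | v | ⟨x, v⟩
  exacts [rfl, rfl, add_add_add_comm _ _ _ _]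

theorem copair_smul (a : ℂ) (f : LinMap M P) (g : LinMap N P) :
    copair (a • f) (a • g) = a • copair f g := by
  refine LinMap.ext (funext fun x => ?_)
  rcases x with x | v | ⟨x, v⟩
  exacts [rfl, rfl, (smul_add' _ _ _).symm]

end LinMap

/-! ### Denotations and their realizers -/

/-- A module without zero, bundled with its structure. -/
structure Dom where
  carrier : Type
  [inst : ZerolessModule carrier]

instance (D : Dom) : ZerolessModule D.carrier := D.inst

/-- The denotation of a proposition. -/
def Ty.den : Ty → Dom
  | one => ⟨ℂ⟩
  | lolli A B => ⟨LinMap A.den.carrier B.den.carrier⟩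
  | oplus A B => ⟨Coprod A.den.carrier B.den.carrier⟩

/-- The elements of the denotation of a proposition. -/
abbrev Den (A : Ty) : Type := A.den.carrier

/-- `Realizes A t d` says that `t` computes the element `d` of the denotation of `A`. This is a
logical relation: at `A ⊸ B`, realizers are sent to realizers. -/
def Realizes : (A : Ty) → Tm → Den A → Prop
  | .one, t, a => Reduces t (.star a)
  | .lolli A B, t, f => ∃ b, Reduces t (.lam b) ∧
      ∀ u d, Realizes A u d → Realizes B (Tm.inst u b) (LinMap.toFun f d)
  | .oplus A B, t, d =>
      (∃ x r, d = Coprod.inl x ∧ Reduces t (.inl r) ∧ Realizes A r x) ∨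
      (∃ y s, d = Coprod.inr y ∧ Reduces t (.inr s) ∧ Realizes B s y) ∨
      (∃ x y r s, d = Coprod.inlr x y ∧ Reduces t (.inlr r s) ∧ Realizes A r x ∧ Realizes B s y)

namespace Realizes

theorem of_reduces {A : Ty} {t t' : Tm} {d : Den A} (h : Reduces t t') (ht : Realizes A t' d) :
    Realizes A t d := by
  cases A with
  | one => exact h.trans ht
  | lolli A B =>
    obtain ⟨b, hb, H⟩ := ht
    exact ⟨b, h.trans hb, H⟩
  | oplus A B =>
    rcases ht with ⟨x, r, e, hr, H⟩ | ⟨y, s, e, hs, H⟩ | ⟨x, y, r, s, e, hrs, H⟩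
    exacts [.inl ⟨x, r, e, h.trans hr, H⟩, .inr (.inl ⟨y, s, e, h.trans hs, H⟩),
      .inr (.inr ⟨x, y, r, s, e, h.trans hrs, H⟩)]

theorem inl {A B : Ty} {t : Tm} {x : Den A} (h : Realizes A t x) :
    Realizes (.oplus A B) (.inl t) (Coprod.inl x : Coprod (Den A) (Den B)) :=
  Or.inl ⟨x, t, rfl, .refl _, h⟩

theorem inr {A B : Ty} {t : Tm} {y : Den B} (h : Realizes B t y) :
    Realizes (.oplus A B) (.inr t) (Coprod.inr y : Coprod (Den A) (Den B)) :=
  Or.inr (.inl ⟨y, t, rfl, .refl _, h⟩)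

theorem inlr {A B : Ty} {t u : Tm} {x : Den A} {y : Den B} (ht : Realizes A t x)
    (hu : Realizes B u y) :
    Realizes (.oplus A B) (.inlr t u) (Coprod.inlr x y : Coprod (Den A) (Den B)) :=
  Or.inr (.inr ⟨x, y, t, u, rfl, .refl _, ht, hu⟩)

theorem sum {A : Ty} {t u : Tm} {d e : Den A} (ht : Realizes A t d) (hu : Realizes A u e) :
    Realizes A (.sum t u) (d + e) := by
  induction A generalizing t u with
  | one => exact (Reduces.sum ht hu).trans (.of_step (.sum_star _ _))
  | lolli A B _ ihB =>
    obtain ⟨b, hb, H⟩ := ht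
    obtain ⟨b', hb', H'⟩ := hu
    exact ⟨.sum b b', (Reduces.sum hb hb').trans (.of_step (.sum_lam _ _)),
      fun u d h => ihB (H u d h) (H' u d h)⟩
  | oplus A B ihA ihB =>
    rcases ht with ⟨x, r, rfl, hr, h⟩ | ⟨v, s, rfl, hr, h⟩ | ⟨x, v, r, s, rfl, hr, h₁, h₂⟩ <;>
    rcases hu with ⟨y, r', rfl, hr', h'⟩ | ⟨w, s', rfl, hr', h'⟩ |
      ⟨y, w, r', s', rfl, hr', h₁', h₂'⟩ <;>
    refine of_reduces ((Reduces.sum hr hr').trans (.sumC _ _)) ?_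
    · exact inl (ihA h h')
    · exact inlr h h'
    · exact inlr (ihA h h₁') h₂'
    · exact inlr h' h
    · exact inr (ihB h h')
    · exact inlr h₁' (ihB h h₂')
    · exact inlr (ihA h₁ h') h₂
    · exact inlr h₁ (ihB h₂ h')
    · exact inlr (ihA h₁ h₁') (ihB h₂ h₂')

theorem prod {A : Ty} (a : ℂ) {t : Tm} {d : Den A} (ht : Realizes A t d) :
    Realizes A (.prod a t) (a • d) := by
  induction A generalizing t with
  | one => exact (Reduces.prod a ht).trans (.of_step (.prod_star _ _))
  | lolli A B _ ihB =>
    obtain ⟨b, hb, H⟩ := ht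
    exact ⟨.prod a b, (Reduces.prod a hb).trans (.of_step (.prod_lam _ _)),
      fun u d h => ihB (H u d h)⟩
  | oplus A B ihA ihB =>
    rcases ht with ⟨x, r, rfl, hr, h⟩ | ⟨v, s, rfl, hr, h⟩ | ⟨x, v, r, s, rfl, hr, h₁, h₂⟩ <;>
    refine of_reduces ((Reduces.prod a hr).trans (.prodC _ _)) ?_
    exacts [inl (ihA h), inr (ihB h), inlr (ihA h₁) (ihB h₂)]

theorem app {A B : Ty} {t u : Tm} {f : LinMap (Den A) (Den B)} {d : Den A}
    (ht : Realizes (.lolli A B) t f) (hu : Realizes A u d) :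
    Realizes B (.app t u) (f.toFun d) := by
  obtain ⟨b, hb, H⟩ := ht
  exact of_reduces ((Reduces.app hb (.refl u)).trans (.of_step (.beta _ _))) (H u d hu)

theorem elimOne {A : Ty} {t u : Tm} {a : ℂ} {d : Den A} (ht : Realizes .one t a)
    (hu : Realizes A u d) : Realizes A (.elimOne t u) (a • d) :=
  of_reduces ((Reduces.elimOne ht (.refl u)).trans (.of_step (.elimOne_star _ _))) (hu.prod a)

theorem elimPlus {A B C : Ty} {t u v : Tm} {d : Coprod (Den A) (Den B)} {f : Den A → Den C}
    {g : Den B → Den C} (ht : Realizes (.oplus A B) t d)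
    (hu : ∀ s x, Realizes A s x → Realizes C (Tm.inst s u) (f x))
    (hv : ∀ s x, Realizes B s x → Realizes C (Tm.inst s v) (g x)) :
    Realizes C (.elimPlus t u v) (d.elim f g) := by
  rcases ht with ⟨x, r, rfl, hr, h⟩ | ⟨y, s, rfl, hr, h⟩ | ⟨x, y, r, s, rfl, hr, h₁, h₂⟩ <;>
  refine of_reduces ((Reduces.elimPlus hr (.refl u) (.refl v)).trans (.elimPlusC _ _ _)) ?_
  exacts [hu _ _ h, hv _ _ h, (hu _ _ h₁).sum (hv _ _ h₂)]

/-- An element of the denotation of a vector proposition has a normal form, to which all its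
realizers reduce. -/
theorem exists_normalForm {C : Ty} (hC : IsVector C) (d : Den C) :
    ∃ v, IsIrreducible v ∧ ∀ t, Realizes C t d → Reduces t v := by
  induction hC with
  | one => exact ⟨.star d, by rintro _ ⟨⟩, fun _ h => h⟩
  | @oplus A B _ _ ihA ihB =>
    rcases d with x | y | ⟨x, y⟩
    · obtain ⟨v, hv, H⟩ := ihA x
      refine ⟨.inl v, fun _ h => ?_, fun t ht => ?_⟩
      · cases h with | inl_arg h => exact hv _ h
      · rcases ht with ⟨_, r, e, hr, h⟩ | ⟨_, s, e, hr, h⟩ | ⟨_, _, r, s, e, hr, h₁, h₂⟩ <;>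
          cases e
        exact hr.trans (H _ h).inl
    · obtain ⟨v, hv, H⟩ := ihB y
      refine ⟨.inr v, fun _ h => ?_, fun t ht => ?_⟩
      · cases h with | inr_arg h => exact hv _ h
      · rcases ht with ⟨_, r, e, hr, h⟩ | ⟨_, s, e, hr, h⟩ | ⟨_, _, r, s, e, hr, h₁, h₂⟩ <;>
          cases e
        exact hr.trans (H _ h).inr
    · obtain ⟨v, hv, H⟩ := ihA x
      obtain ⟨w, hw, H'⟩ := ihB y
      refine ⟨.inlr v w, fun _ h => ?_, fun t ht => ?_⟩
      · cases h with
        | inlr_left _ h => exact hv _ h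
        | inlr_right _ h => exact hw _ h
      · rcases ht with ⟨_, r, e, hr, h⟩ | ⟨_, s, e, hr, h⟩ | ⟨_, _, r, s, e, hr, h₁, h₂⟩ <;>
          cases e
        exact hr.trans ((H _ h₁).inlr (H' _ h₂))

/-- Two realizers of the same element, at a vector proposition, have the same unique normal
form. -/
theorem sameNormalForm {C : Ty} (hC : IsVector C) {t u : Tm} {d : Den C} (ht : Realizes C t d)
    (hu : Realizes C u d) : SameNormalForm t u := by
  obtain ⟨v, hv, H⟩ := exists_normalForm hC d
  exact ⟨v, normalForms_eq_singleton (H t ht) hv, normalForms_eq_singleton (H u hu) hv⟩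

end Realizes

/-! ### Typed terms denote multilinear maps -/

theorem Ctx.Split.left {Γ Γ₁ Γ₂ : Ctx} (h : Ctx.Split Γ Γ₁ Γ₂) (n : ℕ) (A : Ty)
    (hA : Γ₁ n = some A) : Γ n = some A := by
  rcases h n with ⟨e, _⟩ | ⟨e, _⟩
  · rw [← e, hA]
  · simp [hA] at e

theorem Ctx.Split.right {Γ Γ₁ Γ₂ : Ctx} (h : Ctx.Split Γ Γ₁ Γ₂) (n : ℕ) (A : Ty)
    (hA : Γ₂ n = some A) : Γ n = some A := by
  rcases h n with ⟨_, e⟩ | ⟨_, e⟩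
  · simp [hA] at e
  · rw [← e, hA]

/-- An environment for `Γ` gives each declared variable an element of the denotation of its
proposition. -/
def Env (Γ : Ctx) : Type := ∀ (n : ℕ) (A : Ty), Γ n = some A → Den A

namespace Env

/-- Extension of an environment by a value of the variable of index `0`. -/
def cons {A : Ty} {Γ : Ctx} (d : Den A) (ρ : Env Γ) : Env (Ctx.cons A Γ)
  | 0, _, h => Option.some.inj h ▸ d
  | n + 1, B, h => ρ n B h

/-- Restriction of an environment to a smaller context. -/
def restrict {Γ Δ : Ctx} (h : ∀ n A, Δ n = some A → Γ n = some A) (ρ : Env Γ) : Env Δ :=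
  fun n A hA => ρ n A (h n A hA)

/-- The two environments agree on all variables except possibly `n`. -/
def AgreeOff {Γ : Ctx} (n : ℕ) (ρ ρ' : Env Γ) : Prop :=
  ∀ m, m ≠ n → ∀ A h, ρ m A h = ρ' m A h

variable {Γ Δ : Ctx} {n : ℕ} {ρ ρ' : Env Γ}

theorem AgreeOff.cons {A : Ty} (h : AgreeOff n ρ ρ') (d : Den A) :
    AgreeOff (n + 1) (cons d ρ) (cons d ρ')
  | 0, _, _, _ => rfl
  | m + 1, hm, B, hB => h m (fun e => hm (congrArg _ e)) B hB

theorem AgreeOff.restrict (h : AgreeOff n ρ ρ') (hΔ : ∀ n A, Δ n = some A → Γ n = some A) :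
    AgreeOff n (restrict hΔ ρ) (restrict hΔ ρ') :=
  fun m hm A _ => h m hm A _

theorem AgreeOff.restrict_eq (h : AgreeOff n ρ ρ') (hΔ : ∀ n A, Δ n = some A → Γ n = some A)
    (hn : Δ n = none) : Env.restrict hΔ ρ = Env.restrict hΔ ρ' := by
  funext m A hA
  refine h m ?_ A _
  rintro rfl
  simp [hn] at hA

theorem agreeOff_zero_cons {A : Ty} (d d' : Den A) (ρ : Env Γ) :
    AgreeOff 0 (Env.cons d ρ) (Env.cons d' ρ)
  | 0, h, _, _ => absurd rfl h
  | _ + 1, _, _, _ => rfl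

end Env

/-- A map out of environments that is linear in each declared variable. -/
structure IsMultilinear {Γ : Ctx} {M : Type} [ZerolessModule M] (f : Env Γ → M) : Prop where
  map_add {n : ℕ} {A : Ty} (h : Γ n = some A) {ρ ρ₁ ρ₂ : Env Γ} (h₁ : ρ₁.AgreeOff n ρ)
    (h₂ : ρ₂.AgreeOff n ρ) (e : ρ n A h = ρ₁ n A h + ρ₂ n A h) : f ρ = f ρ₁ + f ρ₂
  map_smul {n : ℕ} {A : Ty} (h : Γ n = some A) (a : ℂ) {ρ ρ₁ : Env Γ} (h₁ : ρ₁.AgreeOff n ρ)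
    (e : ρ n A h = a • ρ₁ n A h) : f ρ = a • f ρ₁

namespace IsMultilinear

variable {Γ Γ₁ Γ₂ : Ctx} {M N P : Type} [ZerolessModule M] [ZerolessModule N] [ZerolessModule P]

theorem add {f g : Env Γ → M} (hf : IsMultilinear f) (hg : IsMultilinear g) :
    IsMultilinear fun ρ => f ρ + g ρ where
  map_add h _ _ _ h₁ h₂ e := by
    simp only [hf.map_add h h₁ h₂ e, hg.map_add h h₁ h₂ e, add_add_add_comm]
  map_smul h a _ _ h₁ e := by
    simp only [hf.map_smul h a h₁ e, hg.map_smul h a h₁ e, smul_add']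

theorem comp {f : Env Γ → M} (hf : IsMultilinear f) {φ : M → N}
    (h_add : ∀ x y, φ (x + y) = φ x + φ y) (h_smul : ∀ (a : ℂ) x, φ (a • x) = a • φ x) :
    IsMultilinear fun ρ => φ (f ρ) where
  map_add h _ _ _ h₁ h₂ e := by rw [hf.map_add h h₁ h₂ e, h_add]
  map_smul h a _ _ h₁ e := by rw [hf.map_smul h a h₁ e, h_smul]

/-- The linear map that is obtained from a multilinear one by abstraction of the variable of
index `0`. -/
def curry {A : Ty} {f : Env (Ctx.cons A Γ) → M} (hf : IsMultilinear f) (ρ : Env Γ) :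
    LinMap (Den A) M where
  toFun d := f (ρ.cons d)
  map_add _ _ := hf.map_add rfl (Env.agreeOff_zero_cons _ _ _) (Env.agreeOff_zero_cons _ _ _) rfl
  map_smul a _ := hf.map_smul rfl a (Env.agreeOff_zero_cons _ _ _) rfl

theorem curry_isMultilinear {A : Ty} {f : Env (Ctx.cons A Γ) → M} (hf : IsMultilinear f) :
    IsMultilinear hf.curry where
  map_add {n B} h _ _ _ h₁ h₂ e := LinMap.ext <| funext fun d =>
    hf.map_add (n := n + 1) (A := B) h (h₁.cons d) (h₂.cons d) e
  map_smul {n B} h a _ _ h₁ e := LinMap.ext <| funext fun d =>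
    hf.map_smul (n := n + 1) (A := B) h a (h₁.cons d) e

theorem copair {f : Env Γ → LinMap M P} (hf : IsMultilinear f) {g : Env Γ → LinMap N P}
    (hg : IsMultilinear g) : IsMultilinear fun ρ => (f ρ).copair (g ρ) where
  map_add h _ _ _ h₁ h₂ e := by
    rw [hf.map_add h h₁ h₂ e, hg.map_add h h₁ h₂ e, LinMap.copair_add]
  map_smul h a _ _ h₁ e := by
    rw [hf.map_smul h a h₁ e, hg.map_smul h a h₁ e, LinMap.copair_smul]

/-- A bilinear operation on maps in disjoint sets of variables. Linearity of contexts is what makes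
the result multilinear: each variable occurs in one argument only. -/
theorem bilinear (hs : Ctx.Split Γ Γ₁ Γ₂) {f : Env Γ₁ → M} {g : Env Γ₂ → N}
    (hf : IsMultilinear f) (hg : IsMultilinear g) {φ : M → N → P}
    (add_left : ∀ x y z, φ (x + y) z = φ x z + φ y z)
    (smul_left : ∀ (a : ℂ) x z, φ (a • x) z = a • φ x z)
    (add_right : ∀ z x y, φ z (x + y) = φ z x + φ z y)
    (smul_right : ∀ (a : ℂ) z x, φ z (a • x) = a • φ z x) :
    IsMultilinear fun ρ : Env Γ => φ (f (ρ.restrict hs.left)) (g (ρ.restrict hs.right)) where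
  map_add {n A} h ρ ρ₁ ρ₂ h₁ h₂ e := by
    rcases hs n with ⟨e₁, e₂⟩ | ⟨e₁, e₂⟩
    · rw [hf.map_add (e₁.trans h) (h₁.restrict hs.left) (h₂.restrict hs.left) e, add_left,
        h₁.restrict_eq hs.right e₂, h₂.restrict_eq hs.right e₂]
    · rw [hg.map_add (e₂.trans h) (h₁.restrict hs.right) (h₂.restrict hs.right) e, add_right,
        h₁.restrict_eq hs.left e₁, h₂.restrict_eq hs.left e₁]
  map_smul {n A} h a ρ ρ₁ h₁ e := by
    rcases hs n with ⟨e₁, e₂⟩ | ⟨e₁, e₂⟩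
    · rw [hf.map_smul (e₁.trans h) a (h₁.restrict hs.left) e, smul_left,
        h₁.restrict_eq hs.right e₂]
    · rw [hg.map_smul (e₂.trans h) a (h₁.restrict hs.right) e, smul_right,
        h₁.restrict_eq hs.left e₁]

end IsMultilinear

/-- The substitution `σ` realizes the environment `ρ`, variable by variable. -/
def RealizesEnv {Γ : Ctx} (σ : ℕ → Tm) (ρ : Env Γ) : Prop :=
  ∀ n A h, Realizes A (σ n) (ρ n A h)

namespace RealizesEnv

theorem cons {Γ : Ctx} {σ : ℕ → Tm} {ρ : Env Γ} (h : RealizesEnv σ ρ) {A : Ty} {u : Tm}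
    {d : Den A} (hu : Realizes A u d) : RealizesEnv (Tm.scons u σ) (ρ.cons d)
  | 0, _, e => by cases e; exact hu
  | n + 1, B, e => h n B e

theorem restrict {Γ Δ : Ctx} {σ : ℕ → Tm} {ρ : Env Γ} (h : RealizesEnv σ ρ)
    (hΔ : ∀ n A, Δ n = some A → Γ n = some A) : RealizesEnv σ (ρ.restrict hΔ) :=
  fun n A e => h n A (hΔ n A e)

end RealizesEnv

/-- The fundamental lemma of the logical relation. The denotation is found along with the typing
derivation, because multilinearity is needed to interpret `λ` as a linear map. -/
theorem Typing.exists_denotation {Γ : Ctx} {t : Tm} {A : Ty} (h : Typing Γ t A) :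
    ∃ f : Env Γ → Den A, IsMultilinear f ∧
      ∀ σ ρ, RealizesEnv σ ρ → Realizes A (t.subst σ) (f ρ) := by
  induction h with
  | @ax Γ n A h h' =>
    refine ⟨fun ρ => ρ n A h, ⟨?_, ?_⟩, fun σ ρ H => H n A h⟩
    all_goals
      intro m B hB
      obtain rfl : m = n := by
        by_contra hm
        simp [h' m hm] at hB
      obtain rfl : A = B := Option.some.inj (h.symm.trans hB)
      intros
      assumption
  | sum _ _ ih₁ ih₂ =>
    obtain ⟨f, hf, Hf⟩ := ih₁
    obtain ⟨g, hg, Hg⟩ := ih₂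
    exact ⟨_, hf.add hg, fun σ ρ H => (Hf σ ρ H).sum (Hg σ ρ H)⟩
  | prod a _ ih =>
    obtain ⟨f, hf, Hf⟩ := ih
    exact ⟨_, hf.comp (smul_add' a) (smul_comm' a), fun σ ρ H => (Hf σ ρ H).prod a⟩
  | star a h =>
    refine ⟨fun _ => a, ⟨?_, ?_⟩, fun _ _ _ => Reduces.refl _⟩ <;>
    · intro n B hB
      simp [h n] at hB
  | elimOne hs _ _ ih₁ ih₂ =>
    obtain ⟨f, hf, Hf⟩ := ih₁
    obtain ⟨g, hg, Hg⟩ := ih₂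
    exact ⟨_, hf.bilinear hs hg (φ := fun (a : ℂ) x => a • x) add_smul' mul_smul smul_add'
      (fun a b x => smul_comm' b a x),
      fun σ ρ H => (Hf σ _ (H.restrict _)).elimOne (Hg σ _ (H.restrict _))⟩
  | lam _ ih =>
    obtain ⟨f, hf, Hf⟩ := ih
    refine ⟨_, hf.curry_isMultilinear, fun σ ρ H => ⟨_, .refl _, fun u d hu => ?_⟩⟩
    rw [Tm.inst_subst_upSubst]
    exact Hf _ _ (H.cons hu)
  | @app _ _ _ _ _ A B hs _ _ ih₁ ih₂ =>
    obtain ⟨f, hf, Hf⟩ := ih₁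
    obtain ⟨g, hg, Hg⟩ := ih₂
    exact ⟨_, hf.bilinear hs hg (φ := fun (l : LinMap (Den A) (Den B)) x => l.toFun x)
      (fun _ _ _ => rfl) (fun _ _ _ => rfl) (fun l => l.map_add) (fun a l => l.map_smul a),
      fun σ ρ H => (Hf σ _ (H.restrict _)).app (Hg σ _ (H.restrict _))⟩
  | inl _ ih =>
    obtain ⟨f, hf, Hf⟩ := ih
    exact ⟨_, hf.comp (φ := Coprod.inl) (fun _ _ => rfl) (fun _ _ => rfl),
      fun σ ρ H => (Hf σ ρ H).inl⟩
  | inr _ ih =>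
    obtain ⟨f, hf, Hf⟩ := ih
    exact ⟨_, hf.comp (φ := Coprod.inr) (fun _ _ => rfl) (fun _ _ => rfl),
      fun σ ρ H => (Hf σ ρ H).inr⟩
  | @inlr _ _ _ A B _ _ ih₁ ih₂ =>
    obtain ⟨f, hf, Hf⟩ := ih₁
    obtain ⟨g, hg, Hg⟩ := ih₂
    refine ⟨fun ρ => (Coprod.inlr (f ρ) (g ρ) : Coprod (Den A) (Den B)), ⟨?_, ?_⟩,
      fun σ ρ H => (Hf σ ρ H).inlr (Hg σ ρ H)⟩
    · intro n B h ρ ρ₁ ρ₂ h₁ h₂ e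
      rw [hf.map_add h h₁ h₂ e, hg.map_add h h₁ h₂ e]
      rfl
    · intro n B h a ρ ρ₁ h₁ e
      rw [hf.map_smul h a h₁ e, hg.map_smul h a h₁ e]
      rfl
  | @elimPlus _ _ _ _ _ _ A B C hs _ _ _ ih₁ ih₂ ih₃ =>
    obtain ⟨f, hf, Hf⟩ := ih₁
    obtain ⟨g, hg, Hg⟩ := ih₂
    obtain ⟨k, hk, Hk⟩ := ih₃
    have hgk := hg.curry_isMultilinear.copair hk.curry_isMultilinear
    refine ⟨_, hf.bilinear hs hgk
      (φ := fun x (l : LinMap (Coprod (Den A) (Den B)) (Den C)) => l.toFun x)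
      (fun x y l => l.map_add x y) (fun a x l => l.map_smul a x) (fun _ _ _ => rfl)
      (fun _ _ _ => rfl), fun σ ρ H => (Hf σ _ (H.restrict _)).elimPlus ?_ ?_⟩
    all_goals
      intro s x hs
      rw [Tm.inst_subst_upSubst]
    exacts [Hg _ _ ((H.restrict _).cons hs), Hk _ _ ((H.restrict _).cons hs)]

/-- The denotation of a closed proof. -/
theorem ClosedProof.exists_realizes {t : Tm} {A : Ty} (h : ClosedProof t A) :
    ∃ d, Realizes A t d := by
  obtain ⟨f, -, H⟩ := h.exists_denotation
  have := H Tm.var (fun _ _ h => nomatch h) (fun _ _ h => nomatch h)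
  rw [Tm.subst_var] at this
  exact ⟨_, this⟩

theorem Ctx.split_empty : Ctx.Split Ctx.empty Ctx.empty Ctx.empty := fun _ => .inl ⟨rfl, rfl⟩

/-- Closed proofs with the same denotation cannot be told apart by a context. -/
theorem ObsEq.of_realizes {B : Ty} {t₁ t₂ : Tm} (h₁ : ClosedProof t₁ B) (h₂ : ClosedProof t₂ B)
    {d : Den B} (hd₁ : Realizes B t₁ d) (hd₂ : Realizes B t₂ d) : ObsEq B t₁ t₂ := by
  refine ⟨h₁, h₂, fun C c hC hc => ?_⟩
  obtain ⟨f, -, H⟩ := hc.exists_denotation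
  have key {t : Tm} (ht : Realizes B t d) :
      RealizesEnv (Tm.single t) (Env.cons d fun _ _ h => nomatch h : Env (Ctx.cons B Ctx.empty))
    | 0, _, e => by cases e; exact ht
    | _ + 1, _, e => nomatch e
  exact Realizes.sameNormalForm hC (H _ _ (key hd₁)) (H _ _ (key hd₂))

end QILR

theorem mainTheorem9 (A B : QILR.Ty) (t u₁ u₂ : QILR.Tm) (a : ℂ)
    (ht : QILR.ClosedProof t (QILR.Ty.lolli A B))
    (hu₁ : QILR.ClosedProof u₁ A) (hu₂ : QILR.ClosedProof u₂ A) :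
    QILR.ObsEq B (QILR.Tm.app t (QILR.Tm.sum u₁ u₂))
        (QILR.Tm.sum (QILR.Tm.app t u₁) (QILR.Tm.app t u₂)) ∧
      QILR.ObsEq B (QILR.Tm.app t (QILR.Tm.prod a u₁))
        (QILR.Tm.prod a (QILR.Tm.app t u₁)) := by
  have h₀ := QILR.Ctx.split_empty
  obtain ⟨f, hf⟩ : ∃ f : QILR.LinMap (QILR.Den A) (QILR.Den B),
      QILR.Realizes (.lolli A B) t f := ht.exists_realizes
  obtain ⟨d₁, h₁⟩ := hu₁.exists_realizes
  obtain ⟨d₂, h₂⟩ := hu₂.exists_realizes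
  constructor
  · refine .of_realizes (.app h₀ ht (.sum hu₁ hu₂)) (.sum (.app h₀ ht hu₁) (.app h₀ ht hu₂))
      (hf.app (h₁.sum h₂)) ?_
    rw [QILR.LinMap.map_add]
    exact (hf.app h₁).sum (hf.app h₂)
  · refine .of_realizes (.app h₀ ht (.prod a hu₁)) (.prod a (.app h₀ ht hu₁))
      (hf.app (h₁.prod a)) ?_
    rw [QILR.LinMap.map_smul]
    exact (hf.app h₁).prod a
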